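/- An embedding of a tree $T$ is an injective, adjacency-preserving map from the vertex set of $T$ to itself; let $M=\mathrm{Emb}(T)$ be the monoid of all embeddings of $T$. An end of $T$ is a class of rays (one-way infinite paths), two rays being equivalent if their intersection is a ray; an embedding $g$ maps the end of a ray $R$ to the end of $g(R)$. An embedding is elliptic if it fixes some non-empty finite subtree setwise, and hyperbolic if it is not elliptic and fixes precisely two ends. A vertex $r$ separates a vertex $v$ from an end $\eta$ if the unique ray in $\eta$ starting at $v$ passes through $r$, and a sequence $(x_m)$ of vertices converges to $\eta$ if there is a ray in $\eta$ each of whose vertices separates $x_m$ from $\eta$ for only finitely many $m$. The direction of a non-elliptic embedding $g$ is the end fixed by $g$ to which the sequence $x,g(x),g^2(x),\dots$ converges for every vertex $x$. Let $\mathcal D(M)$ be the set of directions of all non-elliptic elements of $M$. The sibling number $\mathrm{Sib}(T)$ is the number of isomorphism classes of trees $S$ such that $S$ embeds in $T$ and $T$ embeds in $S$ (by injective, adjacency-preserving maps). **Proposition.** Let $T$ be a locally finite tree and $M$ the monoid of embeddings of $T$. If $|\mathcal D(M)|=2$, then $\mathrm{Sib}(T)=1$, and every hyperbolic embedding of $T$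 is an automorphism of $T$. -/

import Mathlib

universe u

namespace TreeSib

variable {V : Type u}

/-- An embedding of `G` into itself is an injective map on the vertices that preserves adjacency.
The embeddings form a monoid under composition. -/
def Emb (G : SimpleGraph V) : Submonoid (G →g G) where
  carrier := {f | Function.Injective f}
  mul_mem' := fun {a b} (ha : Function.Injective a) (hb : Function.Injective b) =>
    show Function.Injective (a ∘ b) from ha.comp hb
  one_mem' := fun _ _ h => h

/-- A ray: a one-way infinite path, listed from its starting vertex. -/
structure Ray (G : SimpleGraph V) where
  vert : ℕ → V
  injective : Function.Injective vert
  adj : ∀ n, G.Adj (vert n) (vert (n + 1))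

/-- Two rays are equivalent if they have a common tail. In a tree, this holds exactly when
the intersection of the two rays is again a ray. -/
def Ray.Equiv {G : SimpleGraph V} (R S : Ray G) : Prop :=
  ∃ m n : ℕ, ∀ k : ℕ, R.vert (m + k) = S.vert (n + k)

theorem Ray.equiv_equivalence (G : SimpleGraph V) :
    Equivalence (Ray.Equiv : Ray G → Ray G → Prop) where
  refl _ := ⟨0, 0, fun _ => rfl⟩
  symm := fun ⟨m, n, h⟩ => ⟨n, m, fun k => (h k).symm⟩
  trans := by
    rintro R S Q ⟨m, n, h⟩ ⟨m', n', h'⟩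
    refine ⟨m + m', n' + n, fun k => ?_⟩
    have h1 := h (m' + k)
    have h2 := h' (n + k)
    rw [show m + m' + k = m + (m' + k) by omega, h1,
      show n + (m' + k) = m' + (n + k) by omega, h2,
      show n' + n + k = n' + (n + k) by omega]

instance Ray.setoid (G : SimpleGraph V) : Setoid (Ray G) :=
  ⟨Ray.Equiv, Ray.equiv_equivalence G⟩

/-- The ends of a tree: the equivalence classes of its rays. -/
def Ends (G : SimpleGraph V) : Type u := Quotient (Ray.setoid G)

/-- The end to which a ray belongs. -/
def Ray.toEnd {G : SimpleGraph V} (R : Ray G) : Ends G := Quotient.mk (Ray.setoid G) R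

/-- The image of a ray under an embedding. -/
def Ray.map {G : SimpleGraph V} (g : Emb G) (R : Ray G) : Ray G where
  vert n := g.1 (R.vert n)
  injective := g.2.comp R.injective
  adj n := g.1.map_adj (R.adj n)

/-- The action of an embedding on the ends: the class of `R` goes to the class of `g(R)`. -/
def Ends.map {G : SimpleGraph V} (g : Emb G) : Ends G → Ends G :=
  Quotient.map (Ray.map g) fun _ _ ⟨m, n, h⟩ => ⟨m, n, fun k => congrArg g.1 (h k)⟩

/-- The set of ends fixed by an embedding. -/
def fixedEnds {G : SimpleGraph V} (g : Emb G) : Set (Ends G) := {η | Ends.map g η = η}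

/-- `g` is elliptic if it fixes (setwise) a non-empty finite subtree. -/
def IsElliptic {G : SimpleGraph V} (g : Emb G) : Prop :=
  ∃ F : Set V, F.Nonempty ∧ F.Finite ∧ (G.induce F).IsTree ∧ g.1 '' F = F

/-- `g` is hyperbolic if it is not elliptic and fixes precisely two ends. -/
def IsHyperbolic {G : SimpleGraph V} (g : Emb G) : Prop :=
  ¬ IsElliptic g ∧ (fixedEnds g).encard = 2

/-- The vertex `r` separates the vertex `v` from the end `η`: the ray of `η` that starts at `v`
(unique in a tree) passes through `r`. -/
def Separates {G : SimpleGraph V} (r v : V) (η : Ends G) : Prop :=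
  ∃ R : Ray G, R.toEnd = η ∧ R.vert 0 = v ∧ r ∈ Set.range R.vert

/-- The sequence of vertices `x` converges to the end `η`: there is a ray `R` in `η` each of whose
vertices separates only finitely many terms of the sequence from `η`. -/
def ConvergesTo {G : SimpleGraph V} (x : ℕ → V) (η : Ends G) : Prop :=
  ∃ R : Ray G, R.toEnd = η ∧ ∀ n, {m : ℕ | Separates (R.vert n) (x m) η}.Finite

/-- `η` is the direction of `g`: the end fixed by `g` to which all sequences
`x, g(x), g(g(x)), …` converge. -/
def IsDirectionOf {G : SimpleGraph V} (η : Ends G) (g : Emb G) : Prop :=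
  Ends.map g η = η ∧ ∀ x : V, ConvergesTo (fun n => g.1^[n] x) η

/-- The set of all directions of the non-elliptic elements of a submonoid `M` of `Emb G`. -/
def directions {G : SimpleGraph V} (M : Submonoid (Emb G)) : Set (Ends G) :=
  {η | ∃ g ∈ M, ¬ IsElliptic g ∧ IsDirectionOf η g}

/-- An embedding is an automorphism if it is (the underlying map of) a graph isomorphism. -/
def IsAutomorphism {G : SimpleGraph V} (g : Emb G) : Prop :=
  ∃ e : G ≃g G, ∀ v, e v = g.1 v

/-- A sibling of `G`: a tree such that each of the two embeds in the other by an injective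
adjacency-preserving map. A sibling has as many vertices as `G`, so up to isomorphism
nothing is lost by taking its vertices in the universe of `V`. -/
structure Sibling (G : SimpleGraph V) where
  vert : Type u
  graph : SimpleGraph vert
  isTree : graph.IsTree
  embeds : graph.IsContained G
  embedded : G.IsContained graph

/-- Isomorphism of siblings. -/
instance Sibling.setoid (G : SimpleGraph V) : Setoid (Sibling G) where
  r S S' := Nonempty (S.graph ≃g S'.graph)
  iseqv :=
    { refl := fun _ => ⟨SimpleGraph.Iso.refl⟩
      symm := fun ⟨e⟩ => ⟨e.symm⟩
      trans := fun ⟨e⟩ ⟨e'⟩ => ⟨e'.comp e⟩ }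

/-- The sibling number: the number of isomorphism classes of siblings. -/
noncomputable def Sib (G : SimpleGraph V) : Cardinal.{u + 1} :=
  Cardinal.mk (Quotient (Sibling.setoid G))

end TreeSib

namespace TreeSib

variable {V : Type u} {T : SimpleGraph V}

/-! ### Distances and nonbacktracking walks in a tree. -/

section Tree

/-! Everything follows from one fact: under the hypothesis every embedding of $T$ is surjective. A
bijective homomorphism between trees is an isomorphism. If $k:S\to T$ and $f:T\to S$ are embeddings,
then surjectivity of $kf$ forces that of $k$, so $S\cong T$.

An elliptic embedding has a power fixing a vertex, and by local finiteness that power permutes each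
ball around the vertex. A non-elliptic $g$ shifts a ray $R$, whose end is its only direction. Let
$h$ shift a ray $S$ towards the other direction, and join the two ends by a line $L$. If $g$ and $h$
both translate all of $L$, say by $l$ and $-m$, then $g^mh^l$ fixes a vertex of $L$, hence is
surjective, and so is $g$.

Both do translate $L$ (`full_full`). Otherwise a suitable product of powers has an axis that starts
along $L$ and later leaves it. Its direction would be an end not on $L$, a third direction. Such
axes come from `exists_shifts`, which extends a path from $x$ to $f(x)$ periodically if it does not
backtrack at the joint. -/

theorem eq_of_adj_of_dist_eq_add_one (hT : T.IsTree) {r u v w : V} (hv : T.Adj v u)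
    (hw : T.Adj w u) (hdv : T.dist r u = T.dist r v + 1) (hdw : T.dist r u = T.dist r w + 1) :
    v = w := by
  obtain ⟨p, -, hp⟩ := hT.connected.exists_path_of_dist r v
  obtain ⟨q, -, hq⟩ := hT.connected.exists_path_of_dist r w
  have hp' := (p.concat hv).isPath_of_length_eq_dist (by simp [hp, hdv])
  have hq' := (q.concat hw).isPath_of_length_eq_dist (by simp [hq, hdw])
  have h := congrArg (fun x : T.Path r u => x.1.penultimate)
    ((hT.isAcyclic.subsingleton_path r u).elim ⟨_, hp'⟩ ⟨_, hq'⟩)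
  simpa using h

/-- A vertex has only one neighbour closer to the root, so a walk that has just stepped away can
step closer only by backtracking. -/
theorem dist_of_nonbacktracking_of_le (hT : T.IsTree) (W : ℕ → V) (n : ℕ)
    (hadj : ∀ i < n, T.Adj (W i) (W (i + 1))) (hne : ∀ i, i + 2 ≤ n → W i ≠ W (i + 2)) :
    T.dist (W 0) (W n) = n := by
  induction n using Nat.strong_induction_on with
  | _ n ih =>
    match n with
    | 0 => simp
    | 1 => exact SimpleGraph.dist_eq_one_iff_adj.2 (hadj 0 one_pos)
    | n + 2 =>
      have h1 := ih (n + 1) (by omega) (fun i hi => hadj i (by omega))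
        (fun i hi => hne i (by omega))
      have h0 := ih n (by omega) (fun i hi => hadj i (by omega)) (fun i hi => hne i (by omega))
      rcases hT.dist_eq_dist_add_one_of_adj (W 0) (hadj (n + 1) (by omega)) with h | h
      · exact absurd (eq_of_adj_of_dist_eq_add_one hT (hadj n (by omega))
          (hadj (n + 1) (by omega)).symm (by omega) h) (hne n le_rfl)
      · rw [show n + 1 + 1 = n + 2 by rfl] at h
        omega

theorem dist_of_nonbacktracking (hT : T.IsTree) {W : ℕ → V}
    (hadj : ∀ i, T.Adj (W i) (W (i + 1))) (hne : ∀ i, W i ≠ W (i + 2)) (i k : ℕ) :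
    T.dist (W i) (W (i + k)) = k := by
  simpa using dist_of_nonbacktracking_of_le hT (fun j => W (i + j)) k
    (fun j _ => hadj (i + j)) (fun j _ => hne (i + j))

theorem Ray.dist (hT : T.IsTree) (R : Ray T) (i k : ℕ) :
    T.dist (R.vert i) (R.vert (i + k)) = k :=
  dist_of_nonbacktracking hT R.adj (fun j h => by have := R.injective h; omega) i k

/-- In a tree, a one-way infinite nonbacktracking walk is a ray. -/
def Ray.ofNonbacktracking (hT : T.IsTree) (W : ℕ → V)
    (hadj : ∀ i, T.Adj (W i) (W (i + 1))) (hne : ∀ i, W i ≠ W (i + 2)) : Ray T where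
  vert := W
  injective := by
    intro i j h
    wlog hij : i ≤ j generalizing i j
    · exact (this h.symm (by omega)).symm
    obtain ⟨k, rfl⟩ := Nat.exists_eq_add_of_le hij
    have := dist_of_nonbacktracking hT hadj hne i k
    rw [← h, SimpleGraph.dist_self] at this
    omega
  adj := hadj

theorem dist_map_le (hT : T.IsTree) (f : Emb T) (u v : V) :
    T.dist (f.1 u) (f.1 v) ≤ T.dist u v := by
  obtain ⟨p, hp⟩ := hT.connected.exists_walk_length_eq_dist u v
  rw [← hp, ← SimpleGraph.Walk.length_map f.1 p]
  exact SimpleGraph.dist_le _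

/-- The image of the path from `u` to `v` is the unique path between the images, which is a single
edge. -/
theorem adj_of_map_adj {W : Type*} {S : SimpleGraph W} (hS : S.IsTree) (hT : T.IsTree)
    (f : S →g T) (hf : Function.Injective f) {u v : W} (h : T.Adj (f u) (f v)) : S.Adj u v := by
  obtain ⟨p, hp, -⟩ := hS.connected.exists_path_of_dist u v
  have hpm := SimpleGraph.Walk.IsPath.map hf hp
  have hne : f u ≠ f v := h.ne
  have hq : h.toWalk.IsPath := by simp [hne]
  have := congrArg (fun x : T.Path (f u) (f v) => x.1.length)
    ((hT.isAcyclic.subsingleton_path (f u) (f v)).elim ⟨_, hpm⟩ ⟨_, hq⟩)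
  exact SimpleGraph.Walk.adj_of_length_eq_one (p := p) (by simpa using this)

end Tree

/-! ### Rays and their ends. -/

section Rays

@[ext]
theorem Ray.ext' {R S : Ray T} (h : ∀ i, R.vert i = S.vert i) : R = S := by
  cases R; cases S
  congr
  exact funext h

theorem Ray.toEnd_eq_iff {R S : Ray T} : R.toEnd = S.toEnd ↔ Ray.Equiv R S :=
  ⟨fun h => Quotient.exact h, fun h => Quotient.sound h⟩

/-- The common tail has the same index on both rays, since indices are distances from the start.
Uniqueness of the neighbour closer to the start carries the agreement backwards. -/
theorem Ray.eq_of_toEnd_eq (hT : T.IsTree) {R S : Ray T} (h : R.toEnd = S.toEnd)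
    (h0 : R.vert 0 = S.vert 0) : R = S := by
  obtain ⟨m, n, h⟩ := Ray.toEnd_eq_iff.1 h
  have hR := fun k => R.dist hT 0 k
  have hS := fun k => S.dist hT 0 k
  simp only [zero_add] at hR hS
  have hmn : m = n := by
    have := h 0
    simp only [add_zero] at this
    rw [← hR m, ← hS n, h0, this]
  subst hmn
  have key : ∀ j k, j + k = m → R.vert j = S.vert j := by
    intro j k
    induction k generalizing j with
    | zero => rintro rfl; exact h 0
    | succ k ih =>
      intro hj
      have hs := ih (j + 1) (by omega)
      refine eq_of_adj_of_dist_eq_add_one hT (r := R.vert 0) (R.adj j) (hs ▸ S.adj j)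
        (by rw [hR, hR]) ?_
      rw [hR, h0, hS]
  ext i
  rcases le_total i m with hi | hi
  · exact key i (m - i) (by omega)
  · obtain ⟨k, rfl⟩ := Nat.exists_eq_add_of_le hi
    exact h k

/-- The ray obtained by deleting the first `n` vertices. -/
def Ray.drop (R : Ray T) (n : ℕ) : Ray T where
  vert i := R.vert (n + i)
  injective i j h := by have := R.injective h; omega
  adj i := R.adj (n + i)

theorem Ray.toEnd_drop (R : Ray T) (n : ℕ) : (R.drop n).toEnd = R.toEnd :=
  Ray.toEnd_eq_iff.2 ⟨0, n, fun k => by simp [Ray.drop]⟩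

theorem Ray.exists_cons (hT : T.IsTree) (R : Ray T) {w : V} (hw : T.Adj w (R.vert 0)) :
    ∃ Q : Ray T, Q.toEnd = R.toEnd ∧ Q.vert 0 = w := by
  by_cases h : w = R.vert 1
  · exact ⟨R.drop 1, R.toEnd_drop 1, h.symm⟩
  · refine ⟨Ray.ofNonbacktracking hT (fun i => Nat.casesOn i w R.vert) ?_ ?_, ?_, rfl⟩
    · rintro (_ | i)
      · exact hw
      · exact R.adj i
    · rintro (_ | i)
      · exact h
      · exact fun h => by have := R.injective h; omega
    · exact Ray.toEnd_eq_iff.2 ⟨1, 0, fun k => by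
        rw [add_comm 1 k, zero_add]; rfl⟩

theorem Ray.exists_start (hT : T.IsTree) (R : Ray T) (v : V) :
    ∃ Q : Ray T, Q.toEnd = R.toEnd ∧ Q.vert 0 = v := by
  obtain ⟨p⟩ := hT.connected v (R.vert 0)
  generalize hu : R.vert 0 = u at p
  induction p with
  | nil => exact ⟨R, rfl, hu⟩
  | cons h p ih =>
    obtain ⟨Q, hQ, h0⟩ := ih hu
    obtain ⟨Q', hQ', h0'⟩ := Q.exists_cons hT (h0 ▸ h)
    exact ⟨Q', hQ'.trans hQ, h0'⟩

/-- Two rays with the same start and different ends share an initial segment and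
separate after it. -/
theorem Ray.exists_branch {R S : Ray T} (h0 : R.vert 0 = S.vert 0) (hne : R ≠ S) :
    ∃ t, R.vert t = S.vert t ∧ R.vert (t + 1) ≠ S.vert (t + 1) := by
  by_contra! h
  refine hne (Ray.ext' fun i => ?_)
  induction i with
  | zero => exact h0
  | succ i ih => exact h i ih

end Rays

/-! ### Non-elliptic embeddings, shifted rays and directions. -/

section Periodic

/-- `f` moves every vertex of `R` forward by `p` steps along `R`. -/
def Shifts (f : Emb T) (R : Ray T) (p : ℕ) : Prop :=
  0 < p ∧ ∀ i, f.1 (R.vert i) = R.vert (i + p)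

/-- A path from a vertex to its image extends periodically to a ray, as long as there is no
backtracking. -/
theorem exists_shifts (hT : T.IsTree) (f : Emb T) (P : ℕ → V) {p : ℕ} (hp : 0 < p)
    (hadj : ∀ i < p, T.Adj (P i) (P (i + 1))) (hne : ∀ i, i + 2 ≤ p → P i ≠ P (i + 2))
    (hend : P p = f.1 (P 0)) (hturn : P (p - 1) ≠ f.1 (P 1)) :
    ∃ R : Ray T, Shifts f R p ∧ ∀ i ≤ p, R.vert i = P i := by
  -- The quotient counts the applications of `f`, the remainder gives the position on the path.
  let W : ℕ → V := fun i => f.1^[i / p] (P (i % p))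
  have hW : ∀ i, W (i + p) = f.1 (W i) := fun i => by
    simp only [W]
    rw [Nat.add_mod_right, Nat.add_div_right _ hp, Function.iterate_succ_apply']
  have hWP : ∀ i < p, W i = P i := fun i hi => by
    simp [W, Nat.mod_eq_of_lt hi, Nat.div_eq_of_lt hi]
  have hWP' : ∀ i ≤ p, W i = P i := fun i hi => by
    rcases hi.lt_or_eq with h | rfl
    · exact hWP i h
    · rw [hend, ← hWP 0 hp, ← hW, zero_add]
  have hA : ∀ i, T.Adj (W i) (W (i + 1)) := by
    intro i
    induction i using Nat.strong_induction_on with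
    | _ i ih =>
      by_cases hi : i < p
      · rw [hWP' i hi.le, hWP' (i + 1) hi]
        exact hadj i hi
      · obtain ⟨k, rfl⟩ := Nat.exists_eq_add_of_le (not_lt.1 hi)
        rw [show p + k = k + p by omega, show k + p + 1 = k + 1 + p by omega, hW, hW]
        exact f.1.map_adj (ih k (by omega))
  have hN : ∀ i, W i ≠ W (i + 2) := by
    intro i
    induction i using Nat.strong_induction_on with
    | _ i ih =>
      by_cases hi : i + 2 ≤ p
      · rw [hWP' i (by omega), hWP' (i + 2) hi]
        exact hne i hi
      · by_cases hi' : i + 1 = p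
        · rw [show i + 2 = 1 + p by omega, hW, hWP' i (by omega), hWP' 1 hp]
          rwa [← hi'] at hturn
        · obtain ⟨k, rfl⟩ := Nat.exists_eq_add_of_le (show p ≤ i by omega)
          rw [show p + k = k + p by omega, show k + p + 2 = k + 2 + p by omega, hW, hW]
          exact fun h => ih k (by omega) (f.2 h)
  exact ⟨Ray.ofNonbacktracking hT W hA hN, ⟨hp, fun i => (hW i).symm⟩, hWP'⟩

theorem Shifts.iterate {f : Emb T} {R : Ray T} {p : ℕ} (h : Shifts f R p) (n i : ℕ) :
    f.1^[n] (R.vert i) = R.vert (i + n * p) := by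
  induction n generalizing i with
  | zero => simp
  | succ n ih =>
    rw [Function.iterate_succ_apply, h.2, ih]
    congr 1
    ring

theorem dist_iterate_le (hT : T.IsTree) (f : Emb T) (n : ℕ) (u v : V) :
    T.dist (f.1^[n] u) (f.1^[n] v) ≤ T.dist u v := by
  induction n with
  | zero => simp
  | succ n ih =>
    rw [Function.iterate_succ_apply', Function.iterate_succ_apply']
    exact (dist_map_le hT f _ _).trans ih

theorem Shifts.not_isElliptic (hT : T.IsTree) {f : Emb T} {R : Ray T} {p : ℕ}
    (h : Shifts f R p) : ¬ IsElliptic f := by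
  rintro ⟨F, ⟨x, hx⟩, hfin, -, hF⟩
  have hmem : ∀ n, f.1^[n] x ∈ F := fun n => by
    induction n with
    | zero => exact hx
    | succ n ih => rw [Function.iterate_succ_apply', ← hF]; exact ⟨_, ih, rfl⟩
  obtain ⟨C, hC⟩ := (hfin.image (fun y => T.dist (R.vert 0) y)).bddAbove
  -- Large enough that `f^n (R.vert 0)`, even after the bounded error of comparing it with `f^n x`,
  -- lies farther than `C` from `R.vert 0`.
  set n := C + T.dist x (R.vert 0) + 1 with hn
  have h1 : T.dist (R.vert 0) (f.1^[n] x) ≤ C := hC ⟨_, hmem n, rfl⟩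
  have h2 := dist_iterate_le hT f n x (R.vert 0)
  have h3 := R.dist hT 0 (n * p)
  rw [← h.iterate] at h3
  have h4 := hT.connected.dist_triangle (u := R.vert 0) (v := f.1^[n] x)
    (w := f.1^[n] (R.vert 0))
  have h5 := Nat.le_mul_of_pos_right n h.1
  omega

theorem Ends.map_toEnd (f : Emb T) (R : Ray T) : Ends.map f R.toEnd = (R.map f).toEnd := rfl

theorem Shifts.isDirectionOf (hT : T.IsTree) {f : Emb T} {R : Ray T} {p : ℕ}
    (h : Shifts f R p) : IsDirectionOf R.toEnd f := by
  have hfix : Ends.map f R.toEnd = R.toEnd := by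
    rw [Ends.map_toEnd, Ray.toEnd_eq_iff]
    exact ⟨0, p, fun k => by simp [Ray.map, h.2, add_comm]⟩
  refine ⟨hfix, fun x => ⟨R, rfl, fun j => ?_⟩⟩
  obtain ⟨Q, hQ, rfl⟩ := R.exists_start hT x
  obtain ⟨a, b, hab⟩ := Ray.toEnd_eq_iff.1 hQ
  have hmap : ∀ n, ∃ Q' : Ray T, Q'.toEnd = R.toEnd ∧ ∀ i, Q'.vert i = f.1^[n] (Q.vert i) := by
    intro n
    induction n with
    | zero => exact ⟨Q, hQ, fun i => rfl⟩
    | succ n ih =>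
      obtain ⟨Q', h1, h2⟩ := ih
      refine ⟨Q'.map f, by rw [← Ends.map_toEnd, h1, hfix], fun i => ?_⟩
      rw [Function.iterate_succ_apply', ← h2]
      rfl
  -- The ray from `f^n x` is `f^n Q`, which after `a` steps is on `R` beyond index `n * p`. For `n >
  -- a + j` its first `a` steps are too few to reach back to `R.vert j`.
  refine (Set.finite_le_nat (a + j)).subset ?_
  rintro n ⟨S, hS, h0, i, hi⟩
  by_contra hn
  simp only [Set.mem_ofPred_eq, not_le] at hn
  obtain ⟨Q', h1, h2⟩ := hmap n
  obtain rfl : S = Q' := Ray.eq_of_toEnd_eq hT (hS.trans h1.symm) (by rw [h0, h2])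
  have hnp := Nat.le_mul_of_pos_right n h.1
  have htail : ∀ k, S.vert (a + k) = R.vert (b + k + n * p) := fun k => by
    rw [h2, hab, h.iterate]
  rcases le_total a i with hai | hai
  · obtain ⟨k, rfl⟩ := Nat.exists_eq_add_of_le hai
    rw [htail] at hi
    have := R.injective hi
    omega
  · obtain ⟨k, rfl⟩ := Nat.exists_eq_add_of_le hai
    have h3 := htail 0
    have h4 := S.dist hT i k
    rw [show i + k = i + k + 0 by rfl, h3, hi] at h4
    obtain ⟨l, hl⟩ := Nat.exists_eq_add_of_le (show j ≤ b + 0 + n * p by omega)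
    rw [hl, R.dist hT] at h4
    omega

/-- The orbit of `R.vert 0` runs out along `R`. Towards a different end, the ray from a late orbit
point returns along `R` to the branch vertex before leaving, so a fixed vertex of that end's ray
separates infinitely many orbit points. -/
theorem IsDirectionOf.eq_toEnd (hT : T.IsTree) {f : Emb T} {R : Ray T} {p : ℕ}
    (h : Shifts f R p) {η : Ends T} (hη : IsDirectionOf η f) : η = R.toEnd := by
  obtain ⟨S, rfl, hS⟩ := hη.2 (R.vert 0)
  by_contra hne
  obtain ⟨Q, hQ, h0⟩ := S.exists_start hT (R.vert 0)
  obtain ⟨t, ht, ht'⟩ := Ray.exists_branch h0 (fun h => hne (by rw [← hQ, h]))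
  obtain ⟨a, b, hab⟩ := Ray.toEnd_eq_iff.1 hQ.symm
  refine (Set.infinite_of_injective_forall_mem (f := fun n => t + n + 1)
    (fun i j h => by simpa using h) (fun n => ?_)) (hS (a + t))
  -- Orbit point number `t + n + 1` lies `c` steps beyond the branch vertex `R.vert t`.
  obtain ⟨c, hc⟩ := Nat.exists_eq_add_of_le
    ((show t ≤ t + n + 1 by omega).trans (Nat.le_mul_of_pos_right (t + n + 1) h.1))
  refine ⟨Ray.ofNonbacktracking hT
    (fun i => if i ≤ c then R.vert (t + (c - i)) else Q.vert (t + (i - c))) ?_ ?_, ?_, ?_, ?_⟩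
  · intro i
    by_cases hi : i + 1 ≤ c
    · simp only [hi, show i ≤ c by omega, if_true]
      have := (R.adj (t + (c - (i + 1)))).symm
      rwa [show t + (c - (i + 1)) + 1 = t + (c - i) by omega] at this
    · by_cases hi' : i = c
      · subst hi'
        simpa [← ht] using Q.adj t
      · simp only [hi, show ¬ i ≤ c by omega, if_false]
        have := (Q.adj (t + (i - c)))
        rwa [show t + (i - c) + 1 = t + (i + 1 - c) by omega] at this
  · intro i
    by_cases hi : i + 2 ≤ c
    · simp only [hi, show i ≤ c by omega, if_true]
      intro h
      have := R.injective h
      omega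
    · by_cases hi' : c < i
      · simp only [hi, show ¬ i ≤ c by omega, if_false]
        intro h
        have := Q.injective h
        omega
      · simp only [hi, show i ≤ c by omega, if_false, if_true]
        by_cases hc' : i = c
        · subst hc'
          simp only [Nat.sub_self, add_zero, Nat.add_sub_cancel_left, ← ht]
          intro h
          have := Q.injective h
          omega
        · rw [show c - i = 1 by omega, show i + 2 - c = 1 by omega]
          exact ht'.symm
  · rw [← hQ, Ray.toEnd_eq_iff]
    refine ⟨c + 1, t + 1, fun k => ?_⟩
    simp only [Ray.ofNonbacktracking, show ¬ c + 1 + k ≤ c by omega, if_false]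
    congr 1
    omega
  · simp only [Ray.ofNonbacktracking, Nat.zero_le, if_true, Nat.sub_zero]
    rw [h.iterate, zero_add, hc]
  · refine ⟨c + b, ?_⟩
    rw [hab]
    rcases Nat.eq_zero_or_pos b with rfl | hb
    · simp [Ray.ofNonbacktracking, ht]
    · simp [Ray.ofNonbacktracking, hb.ne', add_comm]

/-- Take `x` of minimal displacement and the path to its image. Backtracking at the joint would give
the second vertex of the path a smaller displacement or, if the path is an edge, make `f` flip that
edge. -/
theorem exists_shifts_of_not_isElliptic (hT : T.IsTree) {f : Emb T} (hf : ¬ IsElliptic f) :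
    ∃ (R : Ray T) (p : ℕ), Shifts f R p := by
  obtain ⟨v⟩ := hT.connected.nonempty
  obtain ⟨x, hx⟩ : ∃ x, ∀ y, T.dist x (f.1 x) ≤ T.dist y (f.1 y) := by
    have hne : (Set.range fun y => T.dist y (f.1 y)).Nonempty := ⟨_, v, rfl⟩
    obtain ⟨x, hx⟩ := Nat.sInf_mem hne
    exact ⟨x, fun y => hx.trans_le (Nat.sInf_le ⟨y, rfl⟩)⟩
  have hfix : f.1 x ≠ x := fun h => hf ⟨{x}, by simp, by simp,
    SimpleGraph.IsTree.of_subsingleton, by simp [h]⟩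
  obtain ⟨p, hp, hlen⟩ := hT.connected.exists_path_of_dist x (f.1 x)
  have hpos : 0 < p.length := by
    rw [hlen]
    exact hT.connected.pos_dist_of_ne hfix.symm
  have hinj := hp.getVert_injOn
  obtain ⟨R, hR, -⟩ := exists_shifts hT f p.getVert hpos (fun i hi => p.adj_getVert_succ hi)
    (fun i hi h => by
      have := hinj (show i ≤ p.length by omega) (show i + 2 ≤ p.length from hi) h
      omega) (by simp) (fun hturn => by
      rcases Nat.eq_or_lt_of_le (show 1 ≤ p.length from hpos) with h1 | h1
      · rw [← h1] at hturn
        have h2 : p.getVert 1 = f.1 x := by rw [h1]; simp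
        rw [h2] at hturn
        simp only [Nat.sub_self, SimpleGraph.Walk.getVert_zero] at hturn
        have hadj : T.Adj x (f.1 x) := SimpleGraph.Walk.adj_of_length_eq_one h1.symm
        refine hf ⟨{x, f.1 x}, by simp, by simp, ⟨?_, hT.isAcyclic.induce _⟩, ?_⟩
        · exact SimpleGraph.connected_induce_iff.2 (SimpleGraph.Subgraph.top_induce_pair_connected_of_adj hadj)
        · rw [Set.image_pair, ← hturn, Set.pair_comm]
      · have h2 := hx (p.getVert 1)
        rw [← hturn, ← hlen] at h2
        have h3 : T.dist (p.getVert 1) (p.getVert (p.length - 1)) ≤ p.length - 2 := by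
          have := dist_of_nonbacktracking_of_le hT (fun i => p.getVert (1 + i)) (p.length - 2)
            (fun i hi => p.adj_getVert_succ (by omega)) (fun i hi h => by
              have := hinj (show 1 + i ≤ p.length by omega)
                (show 1 + (i + 2) ≤ p.length by omega) h
              omega)
          rw [add_zero, show 1 + (p.length - 2) = p.length - 1 by omega] at this
          exact this.le
        omega)
  exact ⟨R, _, hR⟩

end Periodic

/-! ### The line between the two directions. -/

section Line

/-- A two-way infinite nonbacktracking walk; in a tree, this is a two-way infinite path. -/
structure IsLine (T : SimpleGraph V) (L : ℤ → V) : Prop where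
  adj : ∀ i, T.Adj (L i) (L (i + 1))
  ne : ∀ i, L i ≠ L (i + 2)

theorem IsLine.neg {L : ℤ → V} (hL : IsLine T L) : IsLine T (fun i => L (-i)) where
  adj i := by
    have := (hL.adj (-(i + 1))).symm
    rwa [show -(i + 1) + 1 = -i by ring] at this
  ne i h := hL.ne (-(i + 2)) (by rw [show -(i + 2) + 2 = -i by ring, h])

/-- The ray running along a line from a given position in the positive direction. -/
def IsLine.ray {L : ℤ → V} (hL : IsLine T L) (hT : T.IsTree) (j : ℤ) : Ray T :=
  Ray.ofNonbacktracking hT (fun t => L (j + t))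
    (fun t => by push_cast; rw [← add_assoc]; exact hL.adj _)
    (fun t => by push_cast; rw [← add_assoc]; exact hL.ne _)

theorem IsLine.injective {L : ℤ → V} (hL : IsLine T L) (hT : T.IsTree) :
    Function.Injective L := by
  intro i j h
  wlog hij : i ≤ j generalizing i j
  · exact (this h.symm (by omega)).symm
  have := (hL.ray hT i).injective (a₁ := 0) (a₂ := (j - i).toNat) (by
    simp only [IsLine.ray, Ray.ofNonbacktracking]
    rw [show i + ((0 : ℕ) : ℤ) = i by simp, h]
    congr 1
    omega)
  omega

theorem IsLine.toEnd_ray {L : ℤ → V} (hL : IsLine T L) (hT : T.IsTree) (i j : ℤ) :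
    (hL.ray hT i).toEnd = (hL.ray hT j).toEnd := by
  rw [Ray.toEnd_eq_iff]
  refine ⟨(j - i).toNat, (i - j).toNat, fun k => ?_⟩
  simp only [IsLine.ray, Ray.ofNonbacktracking]
  congr 1
  push_cast
  omega

/-- Every direction is an end of the line `L`. -/
def DirectionsAlong (T : SimpleGraph V) (L : ℤ → V) : Prop :=
  ∀ (f : Emb T) (R : Ray T) (p : ℕ), Shifts f R p →
    (∃ j : ℤ, ∃ n : ℕ, ∀ k : ℕ, R.vert (n + k) = L (j + k)) ∨
    (∃ j : ℤ, ∃ n : ℕ, ∀ k : ℕ, R.vert (n + k) = L (j - k))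

theorem DirectionsAlong.neg {L : ℤ → V} (h : DirectionsAlong T L) :
    DirectionsAlong T (fun i => L (-i)) := by
  intro f R p hR
  rcases h f R p hR with ⟨j, n, h⟩ | ⟨j, n, h⟩
  · exact Or.inr ⟨-j, n, fun k => by rw [h]; congr 1; ring⟩
  · exact Or.inl ⟨-j, n, fun k => by rw [h]; congr 1; ring⟩

/-- A shifted ray cannot follow the line for one step and leave it later. -/
theorem DirectionsAlong.eq_of_start {L : ℤ → V} (hD : DirectionsAlong T L) (hT : T.IsTree)
    (hL : IsLine T L) {f : Emb T} {R : Ray T} {p : ℕ} (hR : Shifts f R p) {j : ℤ}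
    (h0 : R.vert 0 = L j) (h1 : R.vert 1 = L (j + 1)) (t : ℕ) : R.vert t = L (j + t) := by
  rcases hD f R p hR with ⟨i, n, h⟩ | ⟨i, n, h⟩
  · have hend : R.toEnd = (hL.ray hT j).toEnd := by
      rw [hL.toEnd_ray hT j i, Ray.toEnd_eq_iff]
      exact ⟨n, 0, fun k => by simp [h, IsLine.ray, Ray.ofNonbacktracking]⟩
    rw [Ray.eq_of_toEnd_eq hT hend (by simp [h0, IsLine.ray, Ray.ofNonbacktracking])]
    rfl
  · have hend : R.toEnd = (hL.neg.ray hT (-j)).toEnd := by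
      rw [hL.neg.toEnd_ray hT (-j) (-i), Ray.toEnd_eq_iff]
      refine ⟨n, 0, fun k => ?_⟩
      simp only [h, IsLine.ray, Ray.ofNonbacktracking]
      congr 1
      push_cast
      ring
    have hRL := Ray.eq_of_toEnd_eq hT hend (by simp [h0, IsLine.ray, Ray.ofNonbacktracking])
    have h2 : R.vert 1 = L (-(-j + (1 : ℕ))) := by rw [hRL]; rfl
    rw [h1] at h2
    have := hL.injective hT h2
    omega

theorem pow_apply (g : Emb T) (n : ℕ) (v : V) : (g ^ n).1 v = g.1^[n] v := by
  induction n generalizing v with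
  | zero => rfl
  | succ n ih => rw [pow_succ, Function.iterate_succ_apply, ← ih]; rfl

theorem iterate_tail {L : ℤ → V} {g : Emb T} {l : ℕ} {i₀ : ℤ}
    (hg : ∀ i ≥ i₀, g.1 (L i) = L (i + l)) (n : ℕ) :
    ∀ i ≥ i₀, (g ^ n).1 (L i) = L (i + (n * l : ℕ)) := by
  intro i hi
  rw [pow_apply]
  induction n generalizing i with
  | zero => simp
  | succ n ih =>
    rw [Function.iterate_succ_apply, hg i hi, ih _ (by omega)]
    congr 1
    push_cast
    ring

/-- The first failure of translation persists in powers: `g ^ n` translates `L (i₀ - 1 + l)`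
correctly and is injective. -/
theorem iterate_tail_ne {L : ℤ → V} {g : Emb T} {l : ℕ} (hl : 0 < l) {i₀ : ℤ}
    (hg : ∀ i ≥ i₀, g.1 (L i) = L (i + l)) (hg' : g.1 (L (i₀ - 1)) ≠ L (i₀ - 1 + l)) (n : ℕ) :
    (g ^ (n + 1)).1 (L (i₀ - 1)) ≠ L (i₀ - 1 + ((n + 1) * l : ℕ)) := by
  have h := iterate_tail hg n (i₀ - 1 + l) (by omega)
  rw [show i₀ - 1 + (l : ℤ) + (n * l : ℕ) = i₀ - 1 + ((n + 1) * l : ℕ) by push_cast; ring] at h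
  rw [← h, pow_succ]
  exact fun h => hg' ((g ^ n).2 h)

/-- Embeddings that move opposite tails of the line outwards, neither of them preserving the
line, have a product whose direction is not an end of the line. -/
theorem not_partial_partial (hT : T.IsTree) {L : ℤ → V} (hL : IsLine T L)
    (hD : DirectionsAlong T L) {G H : Emb T} {i₀ j₀ l m : ℤ}
    (hG0 : G.1 (L i₀) = L (i₀ + l)) (hG1 : G.1 (L (i₀ + 1)) = L (i₀ + 1 + l))
    (hG' : G.1 (L (i₀ - 1)) ≠ L (i₀ - 1 + l)) (hH : H.1 (L j₀) = L (j₀ - m))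
    (hH' : H.1 (L (j₀ + 1)) ≠ L (j₀ + 1 - m)) (hl : j₀ < i₀ + l) (hm : j₀ - m < i₀) : False := by
  obtain ⟨a, ha⟩ := Int.eq_ofNat_of_zero_le (show 0 ≤ i₀ + l - j₀ by omega)
  obtain ⟨b, hb⟩ := Int.eq_ofNat_of_zero_le (show 0 ≤ i₀ - (j₀ - m) by omega)
  have hinj := hL.injective hT
  -- Follow `L` forwards from `L j₀` to `L (i₀ + l) = G (L i₀)`, then the image under `G` of `L`
  -- backwards to `G (L (j₀ - m)) = G (H (L j₀))`. The failure `hG'` prevents backtracking at the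
  -- corner, `hH'` at the joint.
  let P : ℕ → V := fun t => if t ≤ a then L (j₀ + t) else G.1 (L (i₀ + a - t))
  have hP1 : ∀ t ≤ a, P t = L (j₀ + t) := fun t ht => by simp [P, ht]
  have hP2 : ∀ t, a ≤ t → P t = G.1 (L (i₀ + a - t)) := fun t ht => by
    rcases ht.eq_or_lt with rfl | ht
    · rw [hP1 _ le_rfl, show i₀ + (a : ℤ) - a = i₀ by ring, hG0]
      congr 1
      omega
    · simp [P, show ¬ t ≤ a by omega]
  have hex : ∃ R : Ray T, Shifts (G * H) R (a + b) ∧ ∀ t ≤ a + b, R.vert t = P t := by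
    refine exists_shifts hT (G * H) P (show 0 < a + b by omega) ?_ ?_ ?_ ?_
    · intro i hi
      by_cases hia : i + 1 ≤ a
      · rw [hP1 i (by omega), hP1 _ hia]
        push_cast
        rw [← add_assoc]
        exact hL.adj _
      · rw [hP2 i (by omega), hP2 _ (by omega)]
        have := (hL.adj (i₀ + a - (i + 1 : ℕ))).symm
        rw [show i₀ + a - ((i + 1 : ℕ) : ℤ) + 1 = i₀ + a - i by push_cast; ring] at this
        exact G.1.map_adj this
    · intro i hi h
      by_cases hia : i + 2 ≤ a
      · rw [hP1 i (by omega), hP1 _ hia] at h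
        have := hinj h
        omega
      · by_cases hia' : a ≤ i
        · rw [hP2 i hia', hP2 _ (by omega)] at h
          have := hinj (G.2 h)
          omega
        · rw [hP1 i (by omega), hP2 _ (by omega)] at h
          refine hG' ?_
          rw [show i₀ - 1 + l = j₀ + i by omega, h]
          congr 2
          omega
    · rw [hP2 _ (by omega), hP1 0 (by omega)]
      change _ = G.1 (H.1 _)
      rw [show j₀ + ((0 : ℕ) : ℤ) = j₀ by simp, hH]
      congr 2
      omega
    · rw [hP2 _ (by omega), hP1 1 (by omega)]
      intro h
      refine hH' (Eq.symm (Eq.trans ?_ (G.2 h)))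
      congr 1
      omega
  obtain ⟨R, hR, hRP⟩ := hex
  have h0 : R.vert 0 = L j₀ := by rw [hRP _ (by omega), hP1 _ (by omega)]; simp
  have h1 : R.vert 1 = L (j₀ + 1) := by rw [hRP _ (by omega), hP1 _ (by omega)]; simp
  -- One step past the corner the axis would have to be on `L`, which identifies `G (L (i₀ - 1))`
  -- with `G (L (i₀ + 1))`.
  have h := hD.eq_of_start hT hL hR h0 h1 (a + 1)
  rw [hRP _ (by omega), hP2 _ (by omega),
    show j₀ + ((a + 1 : ℕ) : ℤ) = i₀ + 1 + l by push_cast; omega, ← hG1] at h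
  have := hinj (G.2 h)
  omega

/-- If one embedding translates the line and another moves the opposite tail outwards without
preserving the line, some product has a direction that is not an end of the line. -/
theorem not_full_partial (hT : T.IsTree) {L : ℤ → V} (hL : IsLine T L)
    (hD : DirectionsAlong T L) {g h : Emb T} {l m : ℕ} (hl : 0 < l) {j₀ : ℤ}
    (hg : ∀ i, g.1 (L i) = L (i + l)) (hh : ∀ j ≤ j₀, h.1 (L j) = L (j - m))
    (hh' : h.1 (L (j₀ + 1)) ≠ L (j₀ + 1 - m)) : False := by
  have hinj := hL.injective hT
  have hgk : ∀ i, (g ^ (m + 1)).1 (L i) = L (i + ((m + 1) * l : ℕ)) := fun i =>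
    iterate_tail (i₀ := i) (fun j _ => hg j) _ i le_rfl
  -- The power `m + 1` makes the translation outweigh `m`, so the product with `h` still moves
  -- forwards, by `p + 1`.
  obtain ⟨p, hp⟩ := Nat.exists_eq_add_of_lt (show m < (m + 1) * l by nlinarith)
  set q := (m + 1) * l with hq
  set j₁ : ℤ := j₀ - q with hj₁
  have hf : ∀ i, (h * g ^ (m + 1)).1 (L i) = h.1 (L (i + q)) := fun i => by
    rw [← hgk]; rfl
  obtain ⟨R, hR, hRP⟩ := exists_shifts hT (h * g ^ (m + 1)) (fun t => L (j₁ + t))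
    (show 0 < p + 1 by omega)
    (fun i _ => by push_cast; rw [← add_assoc]; exact hL.adj _)
    (fun i _ => by push_cast; rw [← add_assoc]; exact hL.ne _)
    (by
      rw [hf, hh _ (by omega)]
      congr 1
      push_cast
      omega)
    (fun heq => by
      have h1 := hf (j₁ - 1)
      rw [hh _ (by omega), show j₁ - 1 + (q : ℤ) - m = j₁ + ((p + 1 - 1 : ℕ) : ℤ) by omega,
        heq] at h1
      have := hinj ((h * g ^ (m + 1)).2 h1)
      push_cast at this
      omega)
  have h0 : R.vert 0 = L j₁ := by simp [hRP]
  have h1 : R.vert 1 = L (j₁ + 1) := by rw [hRP 1 (by omega)]; simp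
  -- This vertex of the axis is `h (L (j₀ + 1))`, the first place where `h` fails to translate.
  have h2 := hD.eq_of_start hT hL hR h0 h1 (1 + (p + 1))
  rw [← hR.2, h1, hf] at h2
  refine hh' ?_
  rw [show j₀ + 1 = j₁ + 1 + q by omega, h2]
  congr 1
  push_cast
  omega

/-- The failures of translation are bounded above by `c`, so if there are any, there is a last one,
at `i₀ - 1`. -/
theorem full_or_partial {L : ℤ → V} {g : Emb T} {l : ℕ} {c : ℤ}
    (hg : ∀ i ≥ c, g.1 (L i) = L (i + l)) :
    (∀ i, g.1 (L i) = L (i + l)) ∨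
      ∃ i₀, (∀ i ≥ i₀, g.1 (L i) = L (i + l)) ∧ g.1 (L (i₀ - 1)) ≠ L (i₀ - 1 + l) := by
  by_contra! h
  obtain ⟨⟨i, hi⟩, h⟩ := h
  obtain ⟨z, hz, hz'⟩ := Int.exists_greatest_of_bdd (P := fun j => g.1 (L j) ≠ L (j + l))
    ⟨c, fun j hj => by by_contra hc; exact hj (hg j (by omega))⟩ ⟨i, hi⟩
  refine hz ?_
  have := h (z + 1) (fun j hj => by
    by_contra hc
    have := hz' j hc
    omega)
  rwa [add_sub_cancel_right] at this

/-- Embeddings that move opposite tails of the line outwards translate the whole line. -/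
theorem full_full (hT : T.IsTree) {L : ℤ → V} (hL : IsLine T L)
    (hD : DirectionsAlong T L) {g h : Emb T} {l m : ℕ} (hl : 0 < l) (hm : 0 < m) {c d : ℤ}
    (hg : ∀ i ≥ c, g.1 (L i) = L (i + l)) (hh : ∀ i ≤ d, h.1 (L i) = L (i - m)) :
    (∀ i, g.1 (L i) = L (i + l)) ∧ ∀ i, h.1 (L i) = L (i - m) := by
  have hh2 : ∀ i ≥ -d, h.1 (L (-i)) = L (-(i + m)) := fun i hi => by
    rw [hh _ (by omega)]
    congr 1
    ring
  rcases full_or_partial hg with hgf | ⟨i₀, hg1, hg2⟩ <;>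
    rcases full_or_partial (L := fun i => L (-i)) hh2 with hhf | ⟨j₀, hh3, hh4⟩
  · refine ⟨hgf, fun i => ?_⟩
    have := hhf (-i)
    simp only [neg_neg] at this
    rw [this]
    congr 1
    ring
  · refine (not_full_partial hT hL hD (h := h) (j₀ := -j₀) (m := m) hl hgf (fun j hj => ?_)
      fun he => hh4 ?_).elim
    · have := hh3 (-j) (by omega)
      simp only [neg_neg] at this
      rw [this]
      congr 1
      ring
    · rw [show -(j₀ - 1) = -j₀ + 1 by ring, he]
      congr 1
      ring
  · refine (not_full_partial hT hL.neg hD.neg (h := g) (j₀ := -i₀) (m := l) hm hhf (fun j hj => ?_)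
      fun he => hg2 ?_).elim
    · rw [hg1 _ (by omega)]
      congr 1
      ring
    · beta_reduce at he
      rw [show i₀ - 1 = -(-i₀ + 1) by ring, he]
      congr 1
      ring
  -- Powers above this bound move each tail's first vertex past that of the other tail, as the
  -- strict inequalities of `not_partial_partial` require.
  · set n := (i₀ + j₀).natAbs with hn
    have e1 := iterate_tail hg1 (n + 1)
    have e2 := iterate_tail_ne hl hg1 hg2 n
    have e3 := iterate_tail (L := fun i => L (-i)) hh3 (n + 1)
    have e4 := iterate_tail_ne (L := fun i => L (-i)) hm hh3 hh4 n
    have k1 := Nat.le_mul_of_pos_right (n + 1) hl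
    have k2 := Nat.le_mul_of_pos_right (n + 1) hm
    refine (not_partial_partial hT hL hD (G := g ^ (n + 1)) (H := h ^ (n + 1)) (i₀ := i₀)
      (j₀ := -j₀) (l := ((n + 1) * l : ℕ)) (m := ((n + 1) * m : ℕ)) (e1 _ le_rfl)
      (e1 _ (by omega)) e2 ?_ ?_ (by omega) (by omega)).elim
    · rw [e3 _ le_rfl]
      congr 1
      ring
    · intro h
      refine e4 ?_
      rw [show -(j₀ - 1) = -j₀ + 1 by ring, h]
      congr 1
      ring

end Line

/-! ### Surjectivity of all embeddings. -/

section Surjective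

theorem finite_setOf_dist_le [T.LocallyFinite] (hT : T.IsTree) (v : V) (n : ℕ) :
    {w | T.dist v w ≤ n}.Finite := by
  induction n with
  | zero =>
    refine (Set.finite_singleton v).subset fun w hw => ?_
    exact (hT.connected.dist_eq_zero_iff.1 (Nat.le_zero.1 hw)).symm
  | succ n ih =>
    refine ((Set.finite_singleton v).union
      (ih.biUnion fun u _ => (T.neighborSet u).toFinite)).subset fun w hw => ?_
    obtain ⟨p, hp⟩ := hT.connected.exists_walk_length_eq_dist v w
    by_cases hnil : p.Nil
    · exact Or.inl hnil.eq.symm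
    · refine Or.inr (Set.mem_biUnion (x := p.penultimate) ?_ (p.adj_penultimate hnil))
      have h1 : T.dist v w ≤ n + 1 := hw
      have h2 := SimpleGraph.dist_le p.dropLast
      have h3 := SimpleGraph.Walk.length_dropLast_add_one hnil
      show T.dist v _ ≤ n
      omega

/-- Balls around a fixed vertex are finite, and `f` maps each injectively into itself because it
does not increase distances. -/
theorem surjective_of_map_eq [T.LocallyFinite] (hT : T.IsTree) {f : Emb T} {v : V}
    (hv : f.1 v = v) : Function.Surjective f.1 := by
  intro w
  have hfin := finite_setOf_dist_le hT v (T.dist v w)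
  have hmaps : Set.MapsTo f.1 {u | T.dist v u ≤ T.dist v w} {u | T.dist v u ≤ T.dist v w} := by
    intro u hu
    have := dist_map_le hT f v u
    rw [hv] at this
    exact this.trans hu
  obtain ⟨u, -, hu⟩ := ((hfin.injOn_iff_bijOn_of_mapsTo hmaps).1 f.2.injOn).surjOn
    (show T.dist v w ≤ T.dist v w from le_rfl)
  exact ⟨u, hu⟩

theorem surjective_of_pow {f : Emb T} {n : ℕ} (hn : 0 < n)
    (h : Function.Surjective (f ^ n).1) : Function.Surjective f.1 := by
  obtain ⟨n, rfl⟩ := Nat.exists_eq_add_one.2 hn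
  rw [pow_succ'] at h
  exact Function.Surjective.of_comp (g := (f ^ n).1) h

/-- An orbit in the finite invariant set repeats, so by injectivity a positive power of `f` fixes a
vertex. -/
theorem IsElliptic.surjective [T.LocallyFinite] (hT : T.IsTree) {f : Emb T}
    (hf : IsElliptic f) : Function.Surjective f.1 := by
  obtain ⟨F, ⟨x, hx⟩, hfin, -, hF⟩ := hf
  have hmem : ∀ n, f.1^[n] x ∈ F := fun n => by
    induction n with
    | zero => exact hx
    | succ n ih => rw [Function.iterate_succ_apply', ← hF]; exact ⟨_, ih, rfl⟩
  obtain ⟨a, -, b, -, hab, h⟩ := Set.infinite_univ.exists_ne_map_eq_of_mapsTo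
    (fun n _ => hmem n) hfin
  wlog hlt : a < b generalizing a b
  · exact this b a hab.symm h.symm (by omega)
  obtain ⟨k, rfl⟩ := Nat.exists_eq_add_of_lt hlt
  refine surjective_of_pow (Nat.succ_pos k) (surjective_of_map_eq hT (v := x) ?_)
  rw [pow_apply]
  refine (f.2.iterate a) ?_
  rw [← Function.iterate_add_apply]
  exact h.symm

theorem surjective_of_shifts [T.LocallyFinite] (hT : T.IsTree) {g h : Emb T} {R S : Ray T}
    {l m : ℕ} (hg : Shifts g R l) (hh : Shifts h S m) (hne : R.toEnd ≠ S.toEnd)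
    (hD : ∀ η ∈ directions (⊤ : Submonoid (Emb T)), η = R.toEnd ∨ η = S.toEnd) :
    Function.Surjective g.1 := by
  obtain ⟨Q, hQ, h0⟩ := S.exists_start hT (R.vert 0)
  obtain ⟨t, ht, ht'⟩ := Ray.exists_branch h0 (fun h => hne (by rw [← hQ, h]))
  obtain ⟨a, b, hab⟩ := Ray.toEnd_eq_iff.1 hQ
  -- The two halves are `R` and `Q` from their branch vertex on. They differ at the next step, so
  -- the line does not backtrack at `0`.
  let L : ℤ → V := fun i => if 0 ≤ i then R.vert (t + i.toNat) else Q.vert (t + (-i).toNat)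
  have hLR : ∀ k : ℕ, L k = R.vert (t + k) := fun k => by simp [L]
  have hLQ : ∀ k : ℕ, L (-k) = Q.vert (t + k) := fun k => by
    rcases Nat.eq_zero_or_pos k with rfl | hk
    · simp [L, ht]
    · simp [L, show k ≠ 0 by omega]
  have hL : IsLine T L := by
    constructor
    · intro i
      obtain ⟨k, rfl⟩ | ⟨k, rfl⟩ : (∃ k : ℕ, i = k) ∨ ∃ k : ℕ, i = -(k + 1 : ℕ) := by
        rcases le_or_gt 0 i with h | h
        · exact Or.inl ⟨i.toNat, by omega⟩
        · exact Or.inr ⟨(-i - 1).toNat, by omega⟩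
      · rw [← Nat.cast_succ, hLR, hLR]
        exact R.adj _
      · rw [show -((k + 1 : ℕ) : ℤ) + 1 = -k by push_cast; ring, hLQ, hLQ]
        exact (Q.adj _).symm
    · intro i
      obtain ⟨k, rfl⟩ | rfl | ⟨k, rfl⟩ :
          (∃ k : ℕ, i = k) ∨ i = -1 ∨ ∃ k : ℕ, i = -(k + 2 : ℕ) := by
        rcases le_or_gt 0 i with h | h
        · exact Or.inl ⟨i.toNat, by omega⟩
        · by_cases h1 : i = -1
          · exact Or.inr (Or.inl h1)
          · exact Or.inr (Or.inr ⟨(-i - 2).toNat, by omega⟩)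
      · have : (k : ℤ) + 2 = (k + 2 : ℕ) := by push_cast; ring
        rw [this, hLR, hLR]
        intro h
        have := R.injective h
        omega
      · have h1 := hLQ 1
        have h2 := hLR 1
        rw [Nat.cast_one] at h1 h2
        rw [show (-1 : ℤ) + 2 = 1 by norm_num, h1, h2]
        exact ht'
      · rw [show -((k + 2 : ℕ) : ℤ) + 2 = -k by push_cast; ring, hLQ, hLQ]
        intro h
        have := Q.injective h
        omega
  have hDL : DirectionsAlong T L := by
    intro f E p hE
    rcases hD E.toEnd ⟨f, trivial, hE.not_isElliptic hT, hE.isDirectionOf hT⟩ with h | h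
    · obtain ⟨c, d, hcd⟩ := Ray.toEnd_eq_iff.1 h
      refine Or.inl ⟨d, c + t, fun k => ?_⟩
      rw [← Nat.cast_add, hLR, add_assoc, hcd]
      congr 1
      omega
    · obtain ⟨c, d, hcd⟩ := Ray.toEnd_eq_iff.1 (h.trans hQ.symm)
      refine Or.inr ⟨-d, c + t, fun k => ?_⟩
      rw [show -(d : ℤ) - k = -(d + k : ℕ) by push_cast; ring, hLQ, add_assoc, hcd]
      congr 1
      omega
  -- All of the positive half lies on `R`; the negative half is known to lie on `S` only from `-a`
  -- on.
  obtain ⟨hgL, hhL⟩ := full_full hT hL hDL hg.1 hh.1 (c := 0) (d := -a) (g := g) (h := h)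
    (fun i hi => by
      obtain ⟨k, rfl⟩ := Int.eq_ofNat_of_zero_le hi
      rw [hLR, hg.2, ← Nat.cast_add, hLR, add_assoc])
    (fun i hi => by
      obtain ⟨k, hk⟩ := Int.eq_ofNat_of_zero_le (show 0 ≤ -a - i by omega)
      obtain rfl : i = -(a + k : ℕ) := by push_cast; omega
      rw [show -((a + k : ℕ) : ℤ) - m = -(a + k + m : ℕ) by push_cast; ring, hLQ, hLQ,
        show t + (a + k) = a + (t + k) by omega, hab, hh.2,
        show t + (a + k + m) = a + (t + k + m) by omega, hab, add_assoc b])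
  -- The translations by `m * l` and `-(l * m)` cancel, so the product fixes `L 0`.
  refine surjective_of_pow hh.1 (Function.Surjective.of_comp (g := (h ^ l).1)
    (surjective_of_map_eq hT (f := g ^ m * h ^ l) (v := L 0) ?_))
  have e1 := iterate_tail (L := L) (i₀ := 0 - (l * m : ℕ)) (fun i _ => hgL i) m _ le_rfl
  have e2 := iterate_tail (L := fun i => L (-i)) (g := h) (l := m) (i₀ := 0)
    (fun i _ => by rw [hhL]; congr 1; ring) l 0 le_rfl
  change (g ^ m).1 ((h ^ l).1 (L 0)) = L 0
  simp only [neg_zero, zero_add] at e2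
  rw [e2, ← zero_sub, e1]
  congr 1
  push_cast
  ring

theorem surjective_of_encard_directions [T.LocallyFinite] (hT : T.IsTree)
    (hD : (directions (⊤ : Submonoid (Emb T))).encard = 2) (g : Emb T) :
    Function.Surjective g.1 := by
  by_cases hg : IsElliptic g
  · exact hg.surjective hT
  obtain ⟨R, l, hR⟩ := exists_shifts_of_not_isElliptic hT hg
  have hRD : R.toEnd ∈ directions (⊤ : Submonoid (Emb T)) :=
    ⟨g, trivial, hg, hR.isDirectionOf hT⟩
  obtain ⟨β, hβ, hne, hall⟩ : ∃ β ∈ directions (⊤ : Submonoid (Emb T)), R.toEnd ≠ β ∧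
      ∀ η ∈ directions (⊤ : Submonoid (Emb T)), η = R.toEnd ∨ η = β := by
    obtain ⟨x, y, hxy, hs⟩ := Set.encard_eq_two.1 hD
    rw [hs] at hRD ⊢
    rcases hRD with h | h
    · exact ⟨y, by simp, by rwa [h], fun η hη => by rw [h]; exact hη⟩
    · rw [Set.mem_singleton_iff] at h
      exact ⟨x, by simp, by rw [h]; exact hxy.symm, fun η hη => by rw [h]; exact hη.symm⟩
  obtain ⟨h, -, hh, hdir⟩ := hβ
  obtain ⟨S, m, hS⟩ := exists_shifts_of_not_isElliptic hT hh
  obtain rfl := hdir.eq_toEnd hT hS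
  exact surjective_of_shifts hT hR hS hne hall

/-- A bijective homomorphism between trees is an isomorphism. -/
noncomputable def isoOfBijective {W : Type*} {S : SimpleGraph W} (hS : S.IsTree)
    (hT : T.IsTree) (f : S →g T) (hf : Function.Bijective f) : S ≃g T where
  toEquiv := Equiv.ofBijective f hf
  map_rel_iff' := ⟨adj_of_map_adj hS hT f hf.1, f.map_adj⟩

end Surjective

end TreeSib

theorem mainTheorem6 {V : Type u} (T : SimpleGraph V) [T.LocallyFinite] (hT : T.IsTree)
    (hD : (TreeSib.directions (⊤ : Submonoid (TreeSib.Emb T))).encard = 2) :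
    TreeSib.Sib T = 1 ∧ ∀ g : TreeSib.Emb T, TreeSib.IsHyperbolic g → TreeSib.IsAutomorphism g := by
  have hsurj := TreeSib.surjective_of_encard_directions hT hD
  refine ⟨?_, fun g _ => ⟨TreeSib.isoOfBijective hT hT g.1 ⟨g.2, hsurj g⟩, fun _ => rfl⟩⟩
  have hiso : ∀ S : TreeSib.Sibling T, Nonempty (S.graph ≃g T) := by
    rintro ⟨W, S, hS, ⟨k⟩, ⟨f⟩⟩
    -- The round trip through the sibling is an embedding of `T`, hence onto.
    have h := hsurj ⟨k.toHom.comp f.toHom, k.injective.comp f.injective⟩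
    exact ⟨TreeSib.isoOfBijective hS hT k.toHom
      ⟨k.injective, Function.Surjective.of_comp (g := f) h⟩⟩
  rw [TreeSib.Sib, Cardinal.eq_one_iff_unique]
  refine ⟨⟨fun a b => ?_⟩,
    ⟨Quotient.mk _ ⟨V, T, hT, SimpleGraph.IsContained.rfl, SimpleGraph.IsContained.rfl⟩⟩⟩
  induction a, b using Quotient.inductionOn₂ with
  | _ a b =>
    obtain ⟨e⟩ := hiso a
    obtain ⟨e'⟩ := hiso b
    exact Quotient.sound ⟨e'.symm.comp e⟩
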